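/- Graphs are undirected and may have loops; $G\times H$ is the tensor product (so $(g,h)\sim(g',h')$ iff $g\sim g'$ and $h\sim h'$), and $K^G$ is the exponential graph, whose vertices are all maps $V(G)\to V(K)$, with $f\sim f'$ iff $f(u)\sim f'(v)$ for every edge $uv$ of $G$. An odd cycle in $G$ is a subgraph isomorphic to a cycle graph $C_n$ with $n$ odd ($C_1$ being a vertex with a loop). A graph $K$ is *strongly multiplicative* if, for all finite connected graphs $G,H$ and odd cycles $C$ in $G$ and $D$ in $H$, the existence of a homomorphism $(G\times D)\cup(C\times H)\to K$ implies the existence of a homomorphism $G\to K$ or $H\to K$. Let $\diamondsuit$ be the smallest equivalence relation on walks of $K$ that is compatible with concatenation and makes $(u,v)(v,u)$ and $(a,b)(b,c)(c,d)(d,a)$ equivalent to the empty walk whenever the arcs involved are arcs of $K$; $[W]$ denotes the class of $W$. For a vertex $r$, the $\diamondsuit$-fundamental group $\pi(K,r)_{/\diamondsuit}$ is the group of classes of closed walks at $r$ under concatenation. The $\diamondsuit$-universal cover $\mathcal U(K,r)$ has as vertices the classes of walks starting at $r$, with edges $\{[W],[W(u,v)]\}$ for arcs $(u,v)$; $\tau$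 is the endpoint map to $K$. For a closed walk $R$ at $r$, the $\diamondsuit$-unicyclic cover $\mathcal U(K,r)_{/R}$ is obtained from $\mathcal U(K,r)$ by identifying each orbit of the automorphism $[W]\mapsto[RW]$ to a single vertex; $\tau$ induces a homomorphism $\tau:\mathcal U(K,r)_{/R}\to K$. Finally $\tau(\mathcal U(K,r)^{C})$ is the subgraph of $K^{C}$ that is the image of $\mathcal U(K,r)^{C}$ under composition with $\tau$. **Theorem.** Let $K$ be a finite graph, and let $T$ be a set of vertices of $K$ containing at least one vertex of each connected component of $K$ (if $K$ is connected, one may take $T=\{r\}$ for any vertex $r$). Suppose that $\pi(K,r)_{/\diamondsuit}$ is a free group for every $r\in T$. (A) Suppose that, for every $r\in T$, * $\mathcal U(K,r)_{/R}$ is strongly multiplicative for every closed walk $R$ of odd length at $r$, and * $\tau(\mathcal U(K,r)^{C_n})$ admits a homomorphism to $K$ for every odd $n$. Then $K$ is strongly multiplicative. (B) Let $G,H$ be finite connected graphs, $C$ an odd cycle in $G$, $D$ an odd cycle in $H$, and $\varphi:(G\times D)\cup(C\times H)\to K$ a homomorphism. Then there is $r\in T$ such that at least one of the following holds: * the homomorphism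 $\varphi^*:H\to K^{C}$, $h\mapsto\varphi(-,h)$, factors through the inclusion $\tau(\mathcal U(K,r)^{C})\subseteq K^{C}$; * the homomorphism $\varphi^*:G\to K^{D}$, $g\mapsto\varphi(g,-)$, factors through the inclusion $\tau(\mathcal U(K,r)^{D})\subseteq K^{D}$; * $\varphi$ factors through $\tau:\mathcal U(K,r)_{/R}\to K$ for some closed walk $R$ of odd length at $r$. -/

import Mathlib

/-- A graph on the vertex set `V`: undirected, without multiple edges, loops allowed
(exponential graphs have loops). -/
structure LGraph (V : Type*) where
  Adj : V → V → Prop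
  symm : ∀ u v, Adj u v → Adj v u

namespace LGraph

universe u v w

/-- Graph homomorphisms: maps of the vertices that preserve adjacency. -/
abbrev Hom {V : Type u} {W : Type v} (G : LGraph V) (H : LGraph W) : Type (max u v) :=
  RelHom G.Adj H.Adj

/-- The image of a graph under a map `f` of its vertices: the edges are the images of edges. -/
def map {V : Type u} {W : Type v} (f : V → W) (G : LGraph V) : LGraph W where
  Adj x y := ∃ a b, G.Adj a b ∧ f a = x ∧ f b = y
  symm := by
    rintro x y ⟨a, b, h, ha, hb⟩
    exact ⟨b, a, G.symm a b h, hb, ha⟩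

/-- The subgraph induced on a set of vertices. -/
def restrict {V : Type u} (G : LGraph V) (s : Set V) : LGraph s where
  Adj x y := G.Adj x y
  symm x y h := G.symm x y h

/-- The exponential graph `K ^ G`: its vertices are all functions from the vertices of `G` to
those of `K`. -/
def exp {V : Type u} {W : Type v} (K : LGraph V) (G : LGraph W) : LGraph (W → V) where
  Adj f f' := ∀ a b, G.Adj a b → K.Adj (f a) (f' b)
  symm _ _ h a b hab := K.symm _ _ (h b a (G.symm a b hab))

/-- The cycle graph of length `n` on `ℤ/n` (for `n = 1`, a single vertex with a loop). -/
def cycle (n : ℕ) : LGraph (ZMod n) where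
  Adj i j := j = i + 1 ∨ i = j + 1
  symm _ _ h := h.symm

/-! ### Walks and box-equivalence -/

/-- Walks, as sequences of arcs. -/
inductive Walk {V : Type u} (G : LGraph V) : V → V → Type u
  | nil (a : V) : Walk G a a
  | cons {a b c : V} (h : G.Adj a b) (p : Walk G b c) : Walk G a c

namespace Walk

variable {V : Type u} {G : LGraph V}

/-- The number of arcs of a walk. -/
def length : ∀ {a b : V}, Walk G a b → ℕ
  | _, _, nil _ => 0
  | _, _, cons _ p => p.length + 1

/-- Concatenation of walks. -/
def append : ∀ {a b c : V}, Walk G a b → Walk G b c → Walk G a c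
  | _, _, _, nil _, q => q
  | _, _, _, cons h p, q => cons h (p.append q)

/-- The walk `(a, b)` consisting of a single arc. -/
def arc {a b : V} (h : G.Adj a b) : Walk G a b := cons h (nil b)

/-- The walk traversed backwards. -/
def reverse : ∀ {a b : V}, Walk G a b → Walk G b a
  | _, _, nil a => nil a
  | _, _, cons h p => p.reverse.append (arc (G.symm _ _ h))

theorem append_nil : ∀ {a b : V} (p : Walk G a b), p.append (nil b) = p
  | _, _, nil _ => rfl
  | _, _, cons h p => by rw [append, append_nil p]

theorem append_assoc : ∀ {a b c d : V} (p : Walk G a b) (q : Walk G b c) (s : Walk G c d),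
    (p.append q).append s = p.append (q.append s)
  | _, _, _, _, nil _, _, _ => rfl
  | _, _, _, _, cons h p, q, s => by rw [append, append, append, append_assoc p q s]

end Walk

/-- Box-equivalence: the smallest equivalence relation on walks that is compatible with
concatenation and makes backtracking `(a, b)(b, a)` and the closed walks of length four
`(a, b)(b, c)(c, d)(d, a)` equivalent to the empty walk. -/
inductive BoxEq {V : Type u} {G : LGraph V} : ∀ {a b : V}, Walk G a b → Walk G a b → Prop
  | refl {a b : V} (p : Walk G a b) : BoxEq p p
  | symm {a b : V} {p q : Walk G a b} : BoxEq p q → BoxEq q p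
  | trans {a b : V} {p q s : Walk G a b} : BoxEq p q → BoxEq q s → BoxEq p s
  | backtrack {a b : V} (h : G.Adj a b) (h' : G.Adj b a) :
      BoxEq (.cons h (.cons h' (.nil a))) (.nil a)
  | square {a b c d : V} (h₁ : G.Adj a b) (h₂ : G.Adj b c) (h₃ : G.Adj c d) (h₄ : G.Adj d a) :
      BoxEq (.cons h₁ (.cons h₂ (.cons h₃ (.cons h₄ (.nil a))))) (.nil a)
  | append {a b c : V} {p p' : Walk G a b} {q q' : Walk G b c} :
      BoxEq p p' → BoxEq q q' → BoxEq (p.append q) (p'.append q')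

/-- Box-equivalence as a setoid on the walks between two fixed vertices. -/
def boxSetoid {V : Type u} (G : LGraph V) (a b : V) : Setoid (Walk G a b) where
  r := BoxEq
  iseqv := ⟨BoxEq.refl, BoxEq.symm, BoxEq.trans⟩

/-- Box-equivalence classes of walks from `a` to `b`. -/
def WalkClass {V : Type u} (G : LGraph V) (a b : V) : Type u := Quotient (boxSetoid G a b)

namespace WalkClass

variable {V : Type u} {G : LGraph V}

/-- The class of a walk. -/
def mk {a b : V} (p : Walk G a b) : WalkClass G a b := Quotient.mk (boxSetoid G a b) p

/-- Concatenation of classes. -/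
def comp {a b c : V} (x : WalkClass G a b) (y : WalkClass G b c) : WalkClass G a c :=
  Quotient.map₂ (sa := boxSetoid G a b) (sb := boxSetoid G b c) (sc := boxSetoid G a c)
    Walk.append (fun _ _ hp _ _ hq => BoxEq.append hp hq) x y

theorem reverse_append_boxEq : ∀ {a b : V} (p : Walk G a b),
    BoxEq (p.reverse.append p) (.nil b)
  | _, _, .nil _ => BoxEq.refl _
  | _, _, .cons h p => by
    have key : BoxEq (p.reverse.append ((Walk.cons (G.symm _ _ h) (Walk.cons h (Walk.nil _))).append
        p)) (p.reverse.append ((Walk.nil _).append p)) :=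
      BoxEq.append (BoxEq.refl _) (BoxEq.append (BoxEq.backtrack _ _) (BoxEq.refl _))
    have e : (Walk.cons h p).reverse.append (Walk.cons h p) =
        p.reverse.append ((Walk.cons (G.symm _ _ h) (Walk.cons h (Walk.nil _))).append p) := by
      rw [Walk.reverse, Walk.append_assoc]
      rfl
    rw [e]
    exact BoxEq.trans key (reverse_append_boxEq p)

theorem reverse_boxEq {a b : V} {p q : Walk G a b} (h : BoxEq p q) :
    BoxEq p.reverse q.reverse := by
  have hq : BoxEq (q.append q.reverse) (.nil a) := by
    clear h p
    induction q with
    | nil a => exact BoxEq.refl _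
    | @cons a b c h q ih =>
      have e : (Walk.cons h q).append (Walk.cons h q).reverse =
          (Walk.arc h).append ((q.append q.reverse).append (Walk.arc (G.symm _ _ h))) := by
        rw [Walk.reverse, Walk.append_assoc]
        rfl
      rw [e]
      exact BoxEq.trans (BoxEq.append (BoxEq.refl _) (BoxEq.append ih (BoxEq.refl _)))
        (BoxEq.backtrack h (G.symm _ _ h))
  have h1 : BoxEq (p.reverse.append (q.append q.reverse)) p.reverse := by
    have := BoxEq.append (BoxEq.refl p.reverse) hq
    rwa [Walk.append_nil] at this
  have h2 : BoxEq (p.reverse.append (q.append q.reverse)) q.reverse := by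
    rw [← Walk.append_assoc]
    exact BoxEq.append (BoxEq.trans (BoxEq.append (BoxEq.refl _) (BoxEq.symm h))
      (reverse_append_boxEq p)) (BoxEq.refl _)
  exact BoxEq.trans (BoxEq.symm h1) h2

/-- The class of the reversed walk. -/
def inv {a b : V} (x : WalkClass G a b) : WalkClass G b a :=
  Quotient.map (sa := boxSetoid G a b) (sb := boxSetoid G b a)
    Walk.reverse (fun _ _ h => reverse_boxEq h) x

theorem comp_assoc {a b c d : V} (x : WalkClass G a b) (y : WalkClass G b c)
    (z : WalkClass G c d) : (x.comp y).comp z = x.comp (y.comp z) := by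
  induction x using Quotient.inductionOn
  induction y using Quotient.inductionOn
  induction z using Quotient.inductionOn
  exact congrArg mk (Walk.append_assoc _ _ _)

theorem nil_comp {a b : V} (x : WalkClass G a b) : (mk (.nil a)).comp x = x := by
  induction x using Quotient.inductionOn
  rfl

theorem comp_nil {a b : V} (x : WalkClass G a b) : x.comp (mk (.nil b)) = x := by
  induction x using Quotient.inductionOn
  exact congrArg mk (Walk.append_nil _)

theorem inv_comp {a b : V} (x : WalkClass G a b) : x.inv.comp x = mk (.nil b) := by
  induction x using Quotient.inductionOn
  exact Quotient.sound (reverse_append_boxEq _)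

end WalkClass

/-- The box-fundamental group of `G` at `r`: classes of closed walks rooted at `r`. -/
abbrev boxGroup {V : Type u} (G : LGraph V) (r : V) : Type u := WalkClass G r r

instance {V : Type u} (G : LGraph V) (r : V) : Group (WalkClass G r r) where
  mul x y := x.comp y
  one := WalkClass.mk (.nil r)
  inv x := x.inv
  mul_assoc := WalkClass.comp_assoc
  one_mul := WalkClass.nil_comp
  mul_one := WalkClass.comp_nil
  inv_mul_cancel := WalkClass.inv_comp

/-! ### Covers -/

/-- The vertices of the box-universal cover of `K` at `r`: classes of walks starting at `r`,
with their endpoint as first component. -/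
abbrev UVert {V : Type u} (K : LGraph V) (r : V) : Type u := Σ a : V, WalkClass K r a

/-- The box-universal cover of `K` at `r`: `[W]` is adjacent to `[W (a, b)]`. -/
def universalCover {V : Type u} (K : LGraph V) (r : V) : LGraph (UVert K r) where
  Adj x y := ∃ h : K.Adj x.1 y.1, y.2 = x.2.comp (.mk (Walk.arc h))
  symm := by
    rintro ⟨a, x⟩ ⟨b, y⟩ ⟨h, hy⟩
    refine ⟨K.symm _ _ h, ?_⟩
    have e : (WalkClass.mk (Walk.arc h)).comp (.mk (Walk.arc (K.symm _ _ h))) =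
        WalkClass.mk (.nil a) := Quotient.sound (BoxEq.backtrack _ _)
    dsimp only at hy e ⊢
    rw [hy, WalkClass.comp_assoc, e, WalkClass.comp_nil]

/-- A closed walk `C` at `r` acts on the universal cover by `[W] ↦ [C W]`. -/
instance {V : Type u} (K : LGraph V) (r : V) : MulAction (WalkClass K r r) (UVert K r) where
  smul c x := ⟨x.1, c.comp x.2⟩
  one_smul x := Sigma.ext rfl (heq_of_eq (WalkClass.nil_comp x.2))
  mul_smul c d x := Sigma.ext rfl (heq_of_eq (WalkClass.comp_assoc c d x.2))

/-- The vertices of the unicyclic cover over the closed walk `R`: orbits of the automorphism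
`[W] ↦ [R W]` of the universal cover. -/
abbrev UniVert {V : Type u} (K : LGraph V) {r : V} (R : Walk K r r) : Type u :=
  MulAction.orbitRel.Quotient (Subgroup.zpowers (WalkClass.mk R : boxGroup K r)) (UVert K r)

/-- The box-unicyclic cover of `K` over the closed walk `R`: the universal cover with each orbit
of `[W] ↦ [R W]` identified to a single vertex. -/
def unicyclicCover {V : Type u} (K : LGraph V) {r : V} (R : Walk K r r) :
    LGraph (UniVert K R) :=
  (universalCover K r).map (Quotient.mk _)

/-- The endpoint map from the unicyclic cover to `K`. -/
def unicyclicEnd {V : Type u} (K : LGraph V) {r : V} (R : Walk K r r) (x : UniVert K R) : V :=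
  Quotient.lift (s := MulAction.orbitRel _ _) (fun y : UVert K r => y.1)
    (by rintro a b ⟨c, rfl⟩; rfl) x

/-- The vertices of the image of `(universalCover K r) ^ C_n` in `K ^ C_n`. -/
def tauVerts {V : Type u} (K : LGraph V) (r : V) (n : ℕ) : Set (ZMod n → V) :=
  Set.range (fun (f : ZMod n → UVert K r) (i : ZMod n) => (f i).1)

/-- The image of `(universalCover K r) ^ C_n` under the homomorphism to `K ^ C_n` induced by the
endpoint map, as a subgraph of `K ^ C_n`. -/
def tauImage {V : Type u} (K : LGraph V) (r : V) (n : ℕ) : LGraph (tauVerts K r n) :=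
  (((universalCover K r).exp (cycle n)).map
    (fun (f : ZMod n → UVert K r) (i : ZMod n) => (f i).1)).restrict _

/-! ### Strong multiplicativity -/

/-- A graph is connected if it is nonempty and any two vertices are joined by a walk. -/
def Connected {V : Type u} (G : LGraph V) : Prop :=
  Nonempty V ∧ ∀ a b, Nonempty (Walk G a b)

/-- An odd cycle in `G`: a copy of the cycle graph of some odd length. -/
structure OddCycle {V : Type u} (G : LGraph V) where
  n : ℕ
  odd : Odd n
  vert : ZMod n → V
  inj : Function.Injective vert
  adj : ∀ i, G.Adj (vert i) (vert (i + 1))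

/-- The adjacency relation of an odd cycle, on the vertices of the ambient graph. -/
def OddCycle.Adj {V : Type u} {G : LGraph V} (C : G.OddCycle) : V → V → Prop :=
  ((cycle C.n).map C.vert).Adj

/-- The vertices of `(G × D) ∪ (C × H)`. -/
def crossVerts {V : Type u} {W : Type v} {G : LGraph V} {H : LGraph W}
    (C : G.OddCycle) (D : H.OddCycle) : Set (V × W) :=
  {p | p.2 ∈ Set.range D.vert ∨ p.1 ∈ Set.range C.vert}

/-- The subgraph `(G × D) ∪ (C × H)` of the tensor product `G × H`. -/
def cross {V : Type u} {W : Type v} {G : LGraph V} {H : LGraph W}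
    (C : G.OddCycle) (D : H.OddCycle) : LGraph (crossVerts C D) where
  Adj p q := (G.Adj p.1.1 q.1.1 ∧ D.Adj p.1.2 q.1.2) ∨ (C.Adj p.1.1 q.1.1 ∧ H.Adj p.1.2 q.1.2)
  symm := by
    rintro p q (⟨h, h'⟩ | ⟨h, h'⟩)
    · exact Or.inl ⟨G.symm _ _ h, LGraph.symm _ _ _ h'⟩
    · exact Or.inr ⟨LGraph.symm _ _ _ h, H.symm _ _ h'⟩

/-- The currying `H → K ^ C`, `h ↦ φ(-, h)`, of a map on the vertices of `(G × D) ∪ (C × H)`. -/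
def curryRight {V : Type u} {W : Type v} {X : Type w} {G : LGraph V} {H : LGraph W}
    {C : G.OddCycle} {D : H.OddCycle} (φ : crossVerts C D → X) (h : W) : ZMod C.n → X :=
  fun i => φ ⟨(C.vert i, h), Or.inr ⟨i, rfl⟩⟩

/-- The currying `G → K ^ D`, `g ↦ φ(g, -)`, of a map on the vertices of `(G × D) ∪ (C × H)`. -/
def curryLeft {V : Type u} {W : Type v} {X : Type w} {G : LGraph V} {H : LGraph W}
    {C : G.OddCycle} {D : H.OddCycle} (φ : crossVerts C D → X) (g : V) : ZMod D.n → X :=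
  fun j => φ ⟨(g, D.vert j), Or.inl ⟨j, rfl⟩⟩

/-- `K` (possibly infinite) is strongly multiplicative: for all finite connected graphs `G`, `H`
with odd cycles `C`, `D`, if `(G × D) ∪ (C × H)` has a homomorphism to `K`, then so does `G` or
`H`. (Every finite graph is isomorphic to one whose vertices form a `Type`.) -/
def StronglyMultiplicative {X : Type u} (K : LGraph X) : Prop :=
  ∀ (V W : Type) [Finite V] [Finite W] (G : LGraph V) (H : LGraph W),
    G.Connected → H.Connected → ∀ (C : G.OddCycle) (D : H.OddCycle),
      Nonempty ((cross C D).Hom K) → Nonempty (G.Hom K) ∨ Nonempty (H.Hom K)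

end LGraph

/-!
Choosing a walk ("spoke") from `r` to every vertex of its component turns the arcs of `K` into
elements of the box-fundamental group `π`: the voltage `boxVoltage K r a b` is the class of the
closed walk that uses the spoke to `a`, the arc `(a, b)`, and the spoke to `b` backwards. Voltages
multiply to `1` around backtracks and around closed walks of length four. Lifting a homomorphism
`φ` to the universal cover amounts to writing its voltages as a coboundary, and lifting it to the
unicyclic cover over `R` to doing so modulo powers of `[R]` (`exists_hom_tauImage`,
`exists_hom_unicyclicCover`).

Let `x(c, h) ∈ π` be the voltage of the closed walk in `C × H` that starts at `(c, h)`, turns twice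
around `C`, and alternates in `H` between `h` and a neighbour. Two adjacent walks of this kind form
a ladder of closed walks of length four, so `x` does not depend on the neighbour, and the voltage of
each arc `p q` of `C × H` conjugates `x(q)` to `x(p)` (`IsVoltage.exists_turn`). Likewise, turning
twice around `D` defines `y(g, d)` on `G × D`. At a base point `p₀` of `C × D` let `x₀ = x(p₀)`,
`y₀ = y(p₀)`. If `x₀ = 1`, then `x = 1` everywhere by conjugation, and this is what is needed to
lift `H → K ^ C` edge by edge; if `y₀ = 1`, the same holds for `G → K ^ D`.

Otherwise, `y₀` is the voltage of a closed walk in `C × D`, along which `x` is transported to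
itself, so `x₀` and `y₀` commute. As `π` is free, they have the same centralizer, and it is cyclic,
generated by some `[R]` (`IsFreeGroup.exists_common_centralizer`). The diagonal closed walk in
`C × D` has odd length and its voltage commutes with `x₀`, so it is a power of `[R]`, and `R` is
odd. Finally choose `α(p) ∈ π` conjugating `x(p)` to `x₀` on `C × H` and `y(p)` to `y₀` on `G × D`
(both at once on `C × D`). Then `α(p) · voltage(p q) · α(q)⁻¹` commutes with `x₀` or with `y₀`, so
it is a power of `[R]`, and `φ` factors through the unicyclic cover over `R`.
-/

/-! ### Centralizers in free groups -/

/-- The reduced word of a nontrivial `z` that commutes with a generator `b` begins with `b` or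
`b⁻¹`: otherwise `b * z` is reduced as it stands, hence so is `z * b`, and comparing the two words
shows that `z` begins with `b` after all. So there is only one generator. -/
theorem FreeGroup.subsingleton_of_central {α : Type*} {z : FreeGroup α} (hz : z ≠ 1)
    (hc : ∀ x, z * x = x * z) : Subsingleton α := by
  classical
  refine ⟨fun a b => ?_⟩
  obtain ⟨l, L, hL⟩ : ∃ l L, z.toWord = l :: L :=
    List.exists_cons_of_ne_nil (by simpa using hz)
  have key : ∀ b, l.1 = b := by
    intro b
    by_contra hb
    have h1 : (FreeGroup.of b * z).toWord = (b, true) :: l :: L := by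
      have hr : FreeGroup.reduce (l :: L) = l :: L := by rw [← hL, FreeGroup.reduce_toWord]
      rw [FreeGroup.toWord_mul, FreeGroup.toWord_of, hL, List.singleton_append,
        FreeGroup.reduce.cons, hr]
      have : ¬ (b = l.1 ∧ true = !l.2) := fun h => hb h.1.symm
      simp only [this, if_false]
    have h2 := FreeGroup.toWord_mul_sublist z (FreeGroup.of b)
    rw [hc, h1, FreeGroup.toWord_of, hL] at h2
    -- No letter cancels in `z * b`, since `b * z` is longer than `z`.
    have h3 := h2.eq_of_length (by simp)
    simp only [List.cons_append, List.cons.injEq] at h3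
    exact hb (congrArg Prod.fst h3.1).symm
  rw [← key a, ← key b]

/-- The centralizer of a nontrivial element `x` of a free group is cyclic: by Nielsen–Schreier it
is free, and it has the nontrivial central element `x`. -/
theorem IsFreeGroup.exists_forall_commute_mem_zpowers {Γ : Type*} [Group Γ] [IsFreeGroup Γ]
    {x : Γ} (hx : x ≠ 1) :
    ∃ ρ : Γ, Commute x ρ ∧ ∀ y, Commute x y → y ∈ Subgroup.zpowers ρ := by
  let S := Subgroup.centralizer ({x} : Set Γ)
  have hS : ∀ y, y ∈ S ↔ Commute x y := fun y => by
    simp only [S, Subgroup.mem_centralizer_singleton_iff]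
    exact ⟨fun h => h.symm, fun h => h.symm⟩
  let e := IsFreeGroup.toFreeGroup S
  let x' : S := ⟨x, (hS x).2 (Commute.refl x)⟩
  have hsub : Subsingleton (IsFreeGroup.Generators S) := by
    refine FreeGroup.subsingleton_of_central (z := e x') ?_ fun y => ?_
    · intro h
      have : x' = 1 := e.injective (by rw [h, map_one])
      exact hx (congrArg Subtype.val this)
    · obtain ⟨y, rfl⟩ := e.surjective y
      rw [← map_mul, ← map_mul]
      exact congrArg e (Subtype.ext ((hS y).1 y.2))
  have hcyc : ∃ c : FreeGroup (IsFreeGroup.Generators S), ∀ y, y ∈ Subgroup.zpowers c := by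
    rcases isEmpty_or_nonempty (IsFreeGroup.Generators S) with h | ⟨⟨a⟩⟩
    · exact ⟨1, fun y => by rw [Subsingleton.elim y 1]; exact one_mem _⟩
    · refine ⟨FreeGroup.of a, fun y => ?_⟩
      have hg : ∀ b, FreeGroup.of b ∈ Subgroup.zpowers (FreeGroup.of a) := fun b => by
        rw [Subsingleton.elim b a]; exact Subgroup.mem_zpowers _
      induction y using FreeGroup.induction_on with
      | C1 => exact one_mem _
      | of b => exact hg b
      | inv_of b _ => exact inv_mem (hg b)
      | mul u v hu hv => exact mul_mem hu hv
  obtain ⟨c, hc⟩ := hcyc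
  refine ⟨(e.symm c : S), (hS _).1 (e.symm c).2, fun y hy => ?_⟩
  obtain ⟨k, hk⟩ := hc (e ⟨y, (hS y).2 hy⟩)
  refine ⟨k, ?_⟩
  have : e.symm c ^ k = ⟨y, (hS y).2 hy⟩ := by
    rw [← map_zpow]
    exact e.symm_apply_eq.2 hk
  exact congrArg Subtype.val this

/-- The centralizers of two commuting nontrivial elements of a free group lie in one cyclic
subgroup: being cyclic, each centralizer is contained in the other. -/
theorem IsFreeGroup.exists_common_centralizer {Γ : Type*} [Group Γ] [IsFreeGroup Γ]
    {x y : Γ} (hx : x ≠ 1) (hy : y ≠ 1) (hxy : Commute x y) :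
    ∃ ρ : Γ, (∀ z, Commute x z → z ∈ Subgroup.zpowers ρ) ∧
      ∀ z, Commute y z → z ∈ Subgroup.zpowers ρ := by
  obtain ⟨ρ, -, h1⟩ := IsFreeGroup.exists_forall_commute_mem_zpowers hx
  obtain ⟨σ, -, h2⟩ := IsFreeGroup.exists_forall_commute_mem_zpowers hy
  refine ⟨ρ, h1, fun z hz => h1 z ?_⟩
  obtain ⟨k, rfl⟩ := h2 z hz
  obtain ⟨l, rfl⟩ := h2 x hxy.symm
  exact ((Commute.refl σ).zpow_left l).zpow_right k

namespace LGraph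

universe u v w

/-! ### Voltages and holonomy -/

/-- A voltage on `K` with values in a group `Γ`: a labelling of the arcs that is trivial around
backtracks and around closed walks of length four. Only the values on arcs matter. -/
structure IsVoltage {X : Type u} {Γ : Type v} [Group Γ] (K : LGraph X) (g : X → X → Γ) :
    Prop where
  backtrack : ∀ a b, K.Adj a b → g a b * g b a = 1
  square : ∀ a b c d, K.Adj a b → K.Adj b c → K.Adj c d → K.Adj d a →
    g a b * g b c * g c d * g d a = 1

/-- The product of the voltages along the first `t` steps of a sequence of vertices. -/
def holonomy {X : Type u} {Γ : Type v} [Group Γ] (g : X → X → Γ) (p : ℕ → X) : ℕ → Γ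
  | 0 => 1
  | t + 1 => holonomy g p t * g (p t) (p (t + 1))

section Voltage

variable {X : Type u} {Γ : Type v} [Group Γ] {K : LGraph X} {g : X → X → Γ}

theorem holonomy_add (p : ℕ → X) (s t : ℕ) :
    holonomy g p (s + t) = holonomy g p s * holonomy g (fun i => p (s + i)) t := by
  induction t with
  | zero => simp [holonomy]
  | succ t ih => rw [← add_assoc, holonomy, ih, holonomy, mul_assoc, add_assoc]

/-- Holonomies along a periodic sequence with trivial holonomy around a period are periodic. -/
theorem holonomy_periodic {p : ℕ → X} {N : ℕ} (hp : ∀ t, p (N + t) = p t)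
    (h1 : holonomy g p N = 1) (k t : ℕ) : holonomy g p (N * k + t) = holonomy g p t := by
  induction k with
  | zero => simp
  | succ k ih =>
    rw [show N * (k + 1) + t = N + (N * k + t) by ring, holonomy_add, h1, one_mul]
    simpa only [hp] using ih

theorem IsVoltage.inv_eq (hg : IsVoltage K g) {a b : X} (h : K.Adj a b) : g b a = (g a b)⁻¹ :=
  eq_inv_of_mul_eq_one_right (hg.backtrack a b h)

theorem IsVoltage.square_comm (hg : IsVoltage K g) {a b c d : X} (h₁ : K.Adj a b)
    (h₂ : K.Adj b c) (h₃ : K.Adj d c) (h₄ : K.Adj a d) : g a b * g b c = g a d * g d c := by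
  have := hg.square a b c d h₁ h₂ (K.symm _ _ h₃) (K.symm _ _ h₄)
  rw [hg.inv_eq h₃, hg.inv_eq h₄] at this
  have h := mul_inv_eq_one.1 this
  exact mul_inv_eq_iff_eq_mul.1 h

/-- Two parallel sequences joined by rungs have the same holonomy up to the rungs: every
rectangle of the ladder is a closed walk of length four. -/
theorem IsVoltage.ladder (hg : IsVoltage K g) {p q : ℕ → X}
    (hp : ∀ t, K.Adj (p t) (p (t + 1))) (hq : ∀ t, K.Adj (q t) (q (t + 1)))
    (hpq : ∀ t, K.Adj (p t) (q t)) (t : ℕ) :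
    holonomy g p t * g (p t) (q t) = g (p 0) (q 0) * holonomy g q t := by
  induction t with
  | zero => simp [holonomy]
  | succ t ih =>
    rw [holonomy, holonomy, mul_assoc, hg.square_comm (hp t) (hpq (t + 1)) (hq t) (hpq t),
      ← mul_assoc, ih, mul_assoc]

theorem mul_holonomy {p : ℕ → X} {x : ℕ → Γ}
    (h : ∀ t, x t * g (p t) (p (t + 1)) = g (p t) (p (t + 1)) * x (t + 1)) (t : ℕ) :
    x 0 * holonomy g p t = holonomy g p t * x t := by
  induction t with
  | zero => simp [holonomy]
  | succ t ih => rw [holonomy, ← mul_assoc, ih, mul_assoc, h, mul_assoc]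

/-! ### Zigzags around a cycle -/

/-- For a family `F` of closed sequences indexed by `ZMod n`, the sequence that runs around
`ZMod n` from `i` and takes its values in turn in `F h` and in `F k`. -/
def zigzag {W : Type w} {n : ℕ} (F : W → ZMod n → X) (i : ZMod n) (h k : W) (t : ℕ) : X :=
  F (if Even t then h else k) (i + t)

variable {W : Type w} {H : LGraph W} {n : ℕ} {F : W → ZMod n → X}

theorem zigzag_zero (i : ZMod n) (h k : W) : zigzag F i h k 0 = F h i := by simp [zigzag]

theorem zigzag_period (i : ZMod n) (h k : W) (t : ℕ) :
    zigzag F i h k (2 * n + t) = zigzag F i h k t := by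
  simp [zigzag, Nat.even_add]

theorem zigzag_adj (hF : ∀ h h' i, H.Adj h h' → K.Adj (F h i) (F h' (i + 1))) (i : ZMod n)
    {h k : W} (hk : H.Adj h k) (t : ℕ) :
    K.Adj (zigzag F i h k t) (zigzag F i h k (t + 1)) := by
  have : i + ((t + 1 : ℕ) : ZMod n) = i + t + 1 := by push_cast; ring
  rw [zigzag, zigzag, this]
  apply hF
  by_cases ht : Even t
  · simpa [ht, Nat.even_add_one] using hk
  · simpa [ht, Nat.even_add_one] using H.symm _ _ hk

/-- The ladder between the zigzag from `(i, h)` along `{h, k}` and the one from `(i + 1, h')` along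
`{h', k'}`; its first and last rungs coincide. -/
theorem IsVoltage.zigzag_conj (hg : IsVoltage K g)
    (hF : ∀ h h' i, H.Adj h h' → K.Adj (F h i) (F h' (i + 1))) (i : ZMod n) {h k h' k' : W}
    (hk : H.Adj h k) (hh' : H.Adj h h') (hk' : H.Adj k k') (hhk' : H.Adj h' k') :
    holonomy g (zigzag F i h k) (2 * n) * g (F h i) (F h' (i + 1)) =
      g (F h i) (F h' (i + 1)) * holonomy g (zigzag F (i + 1) h' k') (2 * n) := by
  have := hg.ladder (zigzag_adj hF i hk) (zigzag_adj hF (i + 1) hhk') (fun t => by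
    rw [zigzag, zigzag, add_right_comm]
    apply hF
    by_cases ht : Even t
    · simpa [ht] using hh'
    · simpa [ht] using hk') (2 * n)
  have e : ∀ (i : ZMod n) (h k : W), zigzag F i h k (2 * n) = F h i := fun i h k => by
    rw [← add_zero (2 * n), zigzag_period, zigzag_zero]
  simpa only [e, zigzag_zero] using this

/-- The holonomy of the double turn around the cycle, from `(i, h)` along an edge of `H` at `h`,
does not depend on that edge, and arcs of `C × H` conjugate it into its counterpart at their
other end. -/
theorem IsVoltage.exists_turn (hg : IsVoltage K g)
    (hF : ∀ h h' i, H.Adj h h' → K.Adj (F h i) (F h' (i + 1))) (hnb : ∀ h, ∃ k, H.Adj h k) :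
    ∃ x : ZMod n → W → Γ,
      (∀ i h k, H.Adj h k → x i h = holonomy g (zigzag F i h k) (2 * n)) ∧
      ∀ i h h', H.Adj h h' → x i h * g (F h i) (F h' (i + 1)) =
        g (F h i) (F h' (i + 1)) * x (i + 1) h' := by
  choose nb hnb using hnb
  have indep : ∀ i h k k', H.Adj h k → H.Adj h k' →
      holonomy g (zigzag F i h k) (2 * n) = holonomy g (zigzag F i h k') (2 * n) := by
    intro i h k k' hk hk'
    have h1 := hg.zigzag_conj hF (i - 1) (H.symm _ _ hk) (H.symm _ _ hk) hk hk
    have h2 := hg.zigzag_conj hF (i - 1) (H.symm _ _ hk) (H.symm _ _ hk) hk' hk'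
    rw [sub_add_cancel] at h1 h2
    exact mul_left_cancel (h1.symm.trans h2)
  refine ⟨fun i h => holonomy g (zigzag F i h (nb h)) (2 * n),
    fun i h k hk => indep i h _ _ (hnb h) hk, fun i h h' hh' => ?_⟩
  dsimp only
  rw [indep i h _ _ (hnb h) hh', indep (i + 1) h' _ _ (hnb h') (H.symm _ _ hh')]
  exact hg.zigzag_conj hF i hh' hh' (H.symm _ _ hh') (H.symm _ _ hh')

/-- If the double turn along `{h, h'}` is trivial, then the voltage is a coboundary on
`C × {h, h'}`. -/
theorem exists_potential (hn : Odd n) {h h' : W}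
    (h1 : holonomy g (zigzag F 0 h h') (2 * n) = 1) :
    ∃ α α' : ZMod n → Γ, ∀ i, α' (i + 1) = α i * g (F h i) (F h' (i + 1)) ∧
      α (i + 1) = α' i * g (F h' i) (F h (i + 1)) := by
  have : NeZero n := ⟨hn.pos.ne'⟩
  have hn1 : Even (n + 1) := hn.add_one
  set p := zigzag F 0 h h' with hp
  have per : ∀ s t : ℕ, s % (2 * n) = t % (2 * n) → holonomy g p s = holonomy g p t := by
    intro s t hst
    rw [← Nat.div_add_mod s (2 * n), ← Nat.div_add_mod t (2 * n), hst,
      holonomy_periodic (zigzag_period 0 h h') h1, holonomy_periodic (zigzag_period 0 h h') h1]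
  -- `(n + 1) i` and `(n + 1) i + n` are the even and the odd time at which the zigzag is over `i`.
  have hval : ∀ i : ZMod n, ∃ k : ℕ, (i.val + 1 = (i + 1).val + n * k) := fun i => by
    have h2 : (i + 1).val = (i.val + 1) % n := by
      rw [ZMod.val_add, ZMod.val_one_eq_one_mod, Nat.add_mod_mod]
    exact ⟨(i.val + 1) / n, by rw [h2, Nat.mod_add_div]⟩
  have hstep : ∀ i : ZMod n, ∃ k : ℕ,
      (n + 1) * i.val + (n + 1) = (n + 1) * (i + 1).val + 2 * n * k := fun i => by
    obtain ⟨k, hk⟩ := hval i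
    obtain ⟨m, hm⟩ := hn1
    refine ⟨m * k, ?_⟩
    have : (n + 1) * (i.val + 1) = (n + 1) * ((i + 1).val + n * k) := by rw [hk]
    have h3 : (n + 1) * (n * k) = 2 * n * (m * k) := by rw [hm]; ring
    linarith
  have hpe : ∀ i : ZMod n, p ((n + 1) * i.val) = F h i := fun i => by
    simp [hp, zigzag, hn1]
  have hpo : ∀ i : ZMod n, p ((n + 1) * i.val + n) = F h' i := fun i => by
    have : ¬ Even ((n + 1) * i.val + n) := by
      rw [Nat.not_even_iff_odd]; exact (hn1.mul_right _).add_odd hn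
    simp [hp, zigzag, this]
  refine ⟨fun i => holonomy g p ((n + 1) * i.val), fun i => holonomy g p ((n + 1) * i.val + n),
    fun i => ?_⟩
  obtain ⟨k, hk⟩ := hstep i
  have e1 : (n + 1) * (i + 1).val + n + 2 * n * k = (n + 1) * i.val + 1 + 2 * n := by linarith
  have e2 : (n + 1) * (i + 1).val + 2 * n * k = (n + 1) * i.val + n + 1 := by linarith
  constructor
  · dsimp only
    rw [per ((n + 1) * (i + 1).val + n) ((n + 1) * i.val + 1), holonomy, hpe]
    · congr 2
      simp [hp, zigzag, hn1, Nat.even_add_one]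
    · rw [← Nat.add_mul_mod_self_left _ (2 * n) k, e1, Nat.add_mod_right]
  · dsimp only
    rw [per ((n + 1) * (i + 1).val) ((n + 1) * i.val + n + 1), holonomy, hpo]
    · congr 2
      have : Even ((n + 1) * i.val + n + 1) := by
        rw [add_assoc]; exact (hn1.mul_right _).add hn1
      simp [hp, zigzag, this]
    · rw [← Nat.add_mul_mod_self_left _ (2 * n) k, e2]

end Voltage

/-! ### Connectedness -/

theorem Connected.exists_adj {V : Type u} {G : LGraph V} (hG : G.Connected) (C : G.OddCycle)
    (a : V) : ∃ b, G.Adj a b := by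
  obtain ⟨p⟩ := hG.2 a (C.vert 0)
  cases p with
  | nil => exact ⟨_, C.adj 0⟩
  | cons h _ => exact ⟨_, h⟩

/-- A property of the vertices of `C × H` that passes along arcs holds at all vertices, as `C` is
an odd cycle and `H` is connected: going back and forth along an edge of `H` turns the first
coordinate by `2`, which generates `ZMod n`. -/
theorem Connected.cycle_prod_induction {W : Type w} {H : LGraph W} (hH : H.Connected)
    (hnb : ∀ h, ∃ k, H.Adj h k) {n : ℕ} (hn : Odd n) {S : ZMod n → W → Prop}
    (hS : ∀ i h h', H.Adj h h' → S i h → S (i + 1) h') {i₀ : ZMod n} {h₀ : W} (h0 : S i₀ h₀)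
    (i : ZMod n) (h : W) : S i h := by
  have : NeZero n := ⟨hn.pos.ne'⟩
  have two : ∀ (k : ℕ) i h, S i h → S (i + 2 * k) h := by
    intro k
    induction k with
    | zero => intro i h hi; simpa using hi
    | succ k ih =>
      intro i h hi
      obtain ⟨h', hh'⟩ := hnb h
      have := hS _ _ _ (H.symm _ _ hh') (hS _ _ _ hh' (ih i h hi))
      convert this using 1
      push_cast; ring
  have one : ∀ i h, S i h → S (i + 1) h := by
    intro i h hi
    obtain ⟨m, hm⟩ := hn
    have := two (m + 1) i h hi
    convert this using 2
    have h2 : ((2 * m + 1 : ℕ) : ZMod n) = 0 := by rw [← hm]; simp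
    push_cast at h2 ⊢
    linear_combination -h2
  have all : ∀ i j h, S i h → S j h := by
    intro i j h hi
    have : ∀ k : ℕ, S (i + k) h := by
      intro k
      induction k with
      | zero => simpa using hi
      | succ k ih => have := one _ _ ih; push_cast; rwa [← add_assoc]
    have := this (j - i).val
    rwa [ZMod.natCast_zmod_val, add_sub_cancel] at this
  obtain ⟨p⟩ := hH.2 h₀ h
  refine all i₀ i h ?_
  clear hnb two one
  induction p with
  | nil => exact h0
  | cons hab p ih => exact ih (all _ _ _ (hS _ _ _ hab h0))

theorem cycle_connected {n : ℕ} [NeZero n] : (cycle n).Connected := by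
  refine ⟨⟨0⟩, fun a b => ?_⟩
  have : ∀ k : ℕ, Nonempty (Walk (cycle n) a (a + k)) := by
    intro k
    induction k with
    | zero => rw [Nat.cast_zero, add_zero]; exact ⟨.nil a⟩
    | succ k ih =>
      obtain ⟨p⟩ := ih
      have h : (cycle n).Adj (a + k) (a + (k + 1 : ℕ)) := Or.inl (by push_cast; ring)
      exact ⟨p.append (.arc h)⟩
  have := this (b - a).val
  rwa [ZMod.natCast_zmod_val, add_sub_cancel] at this

/-! ### The voltage with values in the box-fundamental group -/

section BoxVoltage

variable {X : Type u} {K : LGraph X} {r : X}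

theorem WalkClass.comp_inv {a b : X} (x : WalkClass K a b) : x.comp x.inv = mk (.nil a) := by
  have h : x.inv.inv = x := by
    have h1 : (x.inv.inv.comp x.inv).comp x = x.inv.inv.comp (x.inv.comp x) := comp_assoc ..
    rwa [inv_comp, inv_comp, nil_comp, comp_nil, eq_comm] at h1
  have := x.inv.inv_comp
  rwa [h] at this

/-- The class of a single arc. -/
def WalkClass.ofAdj {a b : X} (h : K.Adj a b) : WalkClass K a b := .mk (.arc h)

theorem WalkClass.ofAdj_comp_ofAdj {a b : X} (h : K.Adj a b) (h' : K.Adj b a) :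
    (ofAdj h).comp (ofAdj h') = .mk (.nil a) :=
  Quotient.sound (BoxEq.backtrack h h')

theorem WalkClass.square {a b c d : X} (h₁ : K.Adj a b) (h₂ : K.Adj b c) (h₃ : K.Adj c d)
    (h₄ : K.Adj d a) :
    (ofAdj h₁).comp ((ofAdj h₂).comp ((ofAdj h₃).comp (ofAdj h₄))) = .mk (.nil a) :=
  Quotient.sound (BoxEq.square h₁ h₂ h₃ h₄)

/-- A chosen class of walks from `r` to each vertex of the component of `r`. -/
noncomputable def spoke {a : X} (ha : Nonempty (WalkClass K r a)) : WalkClass K r a := ha.some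

open Classical in
/-- The voltage of an arc in the component of `r`: go from `r` to its tail along the chosen spoke,
then along the arc, then back to `r`. Arcs of other components have voltage `1`. -/
noncomputable def boxVoltage (K : LGraph X) (r a b : X) : boxGroup K r :=
  if h : Nonempty (WalkClass K r a) ∧ K.Adj a b then
    ((spoke h.1).comp (WalkClass.ofAdj h.2)).comp
      (spoke ⟨(spoke h.1).comp (WalkClass.ofAdj h.2)⟩).inv
  else 1

theorem boxVoltage_eq {a b : X} (ha : Nonempty (WalkClass K r a))
    (hb : Nonempty (WalkClass K r b)) (h : K.Adj a b) :
    boxVoltage K r a b = ((spoke ha).comp (WalkClass.ofAdj h)).comp (spoke hb).inv :=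
  dif_pos ⟨ha, h⟩

theorem boxVoltage_comp {a b : X} (ha : Nonempty (WalkClass K r a))
    (hb : Nonempty (WalkClass K r b)) (h : K.Adj a b) :
    (boxVoltage K r a b).comp (spoke hb) = (spoke ha).comp (WalkClass.ofAdj h) := by
  rw [boxVoltage_eq ha hb h, WalkClass.comp_assoc, WalkClass.inv_comp, WalkClass.comp_nil]

theorem boxVoltage_of_isEmpty {a b : X} (ha : ¬ Nonempty (WalkClass K r a)) :
    boxVoltage K r a b = 1 :=
  dif_neg fun h => ha h.1

theorem WalkClass.nonempty_of_adj {a b : X} (ha : Nonempty (WalkClass K r a)) (h : K.Adj a b) :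
    Nonempty (WalkClass K r b) :=
  ha.map fun x => x.comp (ofAdj h)

theorem WalkClass.mul_def (x y : boxGroup K r) : x * y = x.comp y := rfl

theorem WalkClass.one_def : (1 : boxGroup K r) = mk (.nil r) := rfl

theorem WalkClass.comp_right_cancel {a : X} {x y : boxGroup K r} (z : WalkClass K r a)
    (h : x.comp z = y.comp z) : x = y := by
  have := congrArg (fun t => t.comp z.inv) h
  simpa only [comp_assoc, comp_inv, comp_nil] using this

theorem isVoltage_boxVoltage (K : LGraph X) (r : X) : IsVoltage K (boxVoltage K r) where
  backtrack a b h := by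
    by_cases ha : Nonempty (WalkClass K r a)
    · have hb := WalkClass.nonempty_of_adj ha h
      apply WalkClass.comp_right_cancel (spoke ha)
      rw [WalkClass.mul_def, WalkClass.comp_assoc, boxVoltage_comp hb ha (K.symm _ _ h),
        ← WalkClass.comp_assoc, boxVoltage_comp ha hb h, WalkClass.comp_assoc,
        WalkClass.ofAdj_comp_ofAdj, WalkClass.comp_nil, WalkClass.one_def, WalkClass.nil_comp]
    · have hb : ¬ Nonempty (WalkClass K r b) := fun hb =>
        ha (WalkClass.nonempty_of_adj hb (K.symm _ _ h))
      rw [boxVoltage_of_isEmpty ha, boxVoltage_of_isEmpty hb, one_mul]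
  square a b c d h₁ h₂ h₃ h₄ := by
    by_cases ha : Nonempty (WalkClass K r a)
    · have hb := WalkClass.nonempty_of_adj ha h₁
      have hc := WalkClass.nonempty_of_adj hb h₂
      have hd := WalkClass.nonempty_of_adj hc h₃
      apply WalkClass.comp_right_cancel (spoke ha)
      rw [WalkClass.mul_def, WalkClass.comp_assoc, boxVoltage_comp hd ha h₄,
        ← WalkClass.comp_assoc, WalkClass.mul_def, WalkClass.comp_assoc _ _ (spoke hd),
        boxVoltage_comp hc hd h₃, ← WalkClass.comp_assoc _ (spoke hc), WalkClass.mul_def,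
        WalkClass.comp_assoc _ _ (spoke hc), boxVoltage_comp hb hc h₂,
        ← WalkClass.comp_assoc _ (spoke hb), boxVoltage_comp ha hb h₁]
      simp only [WalkClass.comp_assoc]
      rw [WalkClass.square, WalkClass.comp_nil, WalkClass.one_def, WalkClass.nil_comp]
    · have hd : ¬ Nonempty (WalkClass K r d) := fun hd =>
        ha (WalkClass.nonempty_of_adj hd h₄)
      have hc : ¬ Nonempty (WalkClass K r c) := fun hc =>
        hd (WalkClass.nonempty_of_adj hc h₃)
      have hb : ¬ Nonempty (WalkClass K r b) := fun hb =>
        hc (WalkClass.nonempty_of_adj hb h₂)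
      simp only [boxVoltage_of_isEmpty ha, boxVoltage_of_isEmpty hb, boxVoltage_of_isEmpty hc,
        boxVoltage_of_isEmpty hd, one_mul]

/-- The vertex of the universal cover over `a` that differs from the chosen spoke by `x`. -/
noncomputable def lift {a : X} (ha : Nonempty (WalkClass K r a)) (x : boxGroup K r) : UVert K r :=
  ⟨a, x.comp (spoke ha)⟩

theorem lift_adj {a b : X} (ha : Nonempty (WalkClass K r a)) (hb : Nonempty (WalkClass K r b))
    (h : K.Adj a b) (x : boxGroup K r) :
    (universalCover K r).Adj (lift ha x) (lift hb (x * boxVoltage K r a b)) := by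
  refine ⟨h, ?_⟩
  change (x.comp (boxVoltage K r a b)).comp (spoke hb) = (x.comp (spoke ha)).comp (.ofAdj h)
  rw [WalkClass.comp_assoc, WalkClass.comp_assoc, boxVoltage_comp ha hb h]

theorem smul_lift {a : X} (ha : Nonempty (WalkClass K r a)) (x y : boxGroup K r) :
    y • lift ha x = lift ha (y * x) :=
  Sigma.ext rfl (heq_of_eq (WalkClass.comp_assoc y x _).symm)

/-! ### Parity of lengths -/

theorem Walk.length_append : ∀ {a b c : X} (p : Walk K a b) (q : Walk K b c),
    (p.append q).length = p.length + q.length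
  | _, _, _, .nil _, q => (Nat.zero_add _).symm
  | _, _, _, .cons h p, q => by
    rw [Walk.append, Walk.length, Walk.length, Walk.length_append p q]; omega

theorem BoxEq.length_mod_two {a b : X} {p q : Walk K a b} (h : BoxEq p q) :
    (p.length : ZMod 2) = q.length := by
  induction h with
  | refl => rfl
  | symm _ ih => exact ih.symm
  | trans _ _ ih₁ ih₂ => exact ih₁.trans ih₂
  | backtrack => exact (by decide : ((2 : ℕ) : ZMod 2) = (0 : ℕ))
  | square => exact (by decide : ((4 : ℕ) : ZMod 2) = (0 : ℕ))
  | append _ _ ih₁ ih₂ => simp only [Walk.length_append, Nat.cast_add, ih₁, ih₂]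

/-- The parity of the length of a walk, which box-equivalence preserves. -/
def WalkClass.parity {a b : X} (x : WalkClass K a b) : ZMod 2 :=
  Quotient.lift (s := boxSetoid K a b) (fun p => (p.length : ZMod 2))
    (fun _ _ h => BoxEq.length_mod_two h) x

theorem WalkClass.parity_comp {a b c : X} (x : WalkClass K a b) (y : WalkClass K b c) :
    (x.comp y).parity = x.parity + y.parity := by
  induction x using Quotient.inductionOn
  induction y using Quotient.inductionOn
  exact (congrArg Nat.cast (Walk.length_append _ _)).trans (Nat.cast_add _ _)

theorem parity_holonomy {p : ℕ → X} (hp : ∀ t, K.Adj (p t) (p (t + 1)))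
    (hr : ∀ t, Nonempty (WalkClass K r (p t))) (t : ℕ) :
    (holonomy (boxVoltage K r) p t).parity + (spoke (hr t)).parity =
      (spoke (hr 0)).parity + t := by
  induction t with
  | zero =>
    have : (1 : boxGroup K r).parity = 0 := rfl
    simp [holonomy, this]
  | succ t ih =>
    have h1 : (WalkClass.ofAdj (hp t)).parity = 1 := rfl
    rw [holonomy, WalkClass.mul_def, WalkClass.parity_comp, add_assoc, ← WalkClass.parity_comp,
      boxVoltage_comp (hr t) (hr (t + 1)) (hp t), WalkClass.parity_comp, h1, ← add_assoc, ih]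
    push_cast; ring

/-- Parity as a homomorphism on the box-fundamental group. -/
def parityHom (K : LGraph X) (r : X) : boxGroup K r →* Multiplicative (ZMod 2) where
  toFun x := .ofAdd (WalkClass.parity x)
  map_one' := rfl
  map_mul' x y := congrArg Multiplicative.ofAdd (WalkClass.parity_comp x y)

/-- An element of the box-fundamental group with an odd power is the class of an odd walk. -/
theorem exists_odd_walk {ρ x : boxGroup K r} (hx : x.parity = 1)
    (h : x ∈ Subgroup.zpowers ρ) : ∃ R : Walk K r r, Odd R.length ∧ WalkClass.mk R = ρ := by
  obtain ⟨R, rfl⟩ := Quotient.exists_rep ρ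
  refine ⟨R, ?_, rfl⟩
  obtain ⟨k, rfl⟩ := h
  by_contra hR
  have h0 : parityHom K r (WalkClass.mk R) = 1 := by
    change Multiplicative.ofAdd (R.length : ZMod 2) = 1
    rw [(ZMod.natCast_eq_zero_iff_even).2 (Nat.not_odd_iff_even.1 hR)]
    rfl
  have h1 := map_zpow (parityHom K r) (WalkClass.mk R) k
  rw [h0, one_zpow] at h1
  have h2 : (1 : ZMod 2) = 0 := hx.symm.trans (Multiplicative.ofAdd.injective h1)
  exact one_ne_zero h2

end BoxVoltage

/-! ### Factoring through covers -/

section Factor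

variable {X : Type u} {K : LGraph X} {r : X}

/-- If the double turn around `C_n` is trivial, then a homomorphism to `K ^ C_n` factors through
the image of `(universalCover K r) ^ C_n`. -/
theorem exists_hom_tauImage {W : Type w} {H : LGraph W} {n : ℕ} (hn : Odd n)
    {F : W → ZMod n → X} (hF : ∀ h h' i, H.Adj h h' → K.Adj (F h i) (F h' (i + 1)))
    (hr : ∀ h i, Nonempty (WalkClass K r (F h i)))
    (h1 : ∀ h h', H.Adj h h' → holonomy (boxVoltage K r) (zigzag F 0 h h') (2 * n) = 1) :
    ∃ ψ : H.Hom (tauImage K r n), ∀ h, (ψ h : ZMod n → X) = F h := by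
  refine ⟨⟨fun h => ⟨F h, fun i => lift (hr h i) 1, rfl⟩, fun {h h'} hh' => ?_⟩, fun h => rfl⟩
  obtain ⟨α, α', hα⟩ := exists_potential (g := boxVoltage K r) hn (h1 h h' hh')
  refine ⟨fun i => lift (hr h i) (α i), fun i => lift (hr h' i) (α' i), ?_, rfl, rfl⟩
  rintro i j (rfl | rfl)
  · dsimp only
    rw [(hα i).1]
    exact lift_adj _ _ (hF _ _ _ hh') _
  · dsimp only
    rw [(hα j).2]
    exact (universalCover K r).symm _ _ (lift_adj _ _ (hF _ _ _ (H.symm _ _ hh')) _)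

/-- A homomorphism to `K` whose voltages are, up to a change of spokes, powers of the class of
`R` factors through the unicyclic cover over `R`. -/
theorem exists_hom_unicyclicCover {Y : Type w} {G : LGraph Y} (φ : G.Hom K) (R : Walk K r r)
    (hr : ∀ p, Nonempty (WalkClass K r (φ p))) (α : Y → boxGroup K r)
    (hα : ∀ p q, G.Adj p q → α p * boxVoltage K r (φ p) (φ q) * (α q)⁻¹ ∈
      Subgroup.zpowers (WalkClass.mk R : boxGroup K r)) :
    ∃ ψ : G.Hom (unicyclicCover K R), ∀ p, unicyclicEnd K R (ψ p) = φ p := by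
  refine ⟨⟨fun p => Quotient.mk _ (lift (hr p) (α p)), fun {p q} hpq => ?_⟩, fun p => rfl⟩
  refine ⟨_, _, lift_adj (hr p) (hr q) (φ.map_rel hpq) (α p), rfl, Quotient.sound ?_⟩
  refine ⟨⟨_, hα p q hpq⟩, ?_⟩
  change (α p * boxVoltage K r (φ p) (φ q) * (α q)⁻¹) • lift (hr q) (α q) = _
  rw [smul_lift, inv_mul_cancel_right]

end Factor

/-! ### Homomorphisms from `(G × D) ∪ (C × H)` -/

/-- What a homomorphism `F : H → K ^ C_n` provides: an element `x i h` for each vertex of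
`C_n × H`, conjugated into each other by the voltages of arcs; if one of these elements is
trivial, then `F` factors through the image of `(universalCover K r) ^ C_n`. -/
theorem Connected.exists_turn {X : Type u} {K : LGraph X} {r : X} {W : Type w} {H : LGraph W}
    (hH : H.Connected) (hnb : ∀ h, ∃ k, H.Adj h k) {n : ℕ} (hn : Odd n) {F : W → ZMod n → X}
    (hF : ∀ h h' i, H.Adj h h' → K.Adj (F h i) (F h' (i + 1)))
    (hr : ∀ h i, Nonempty (WalkClass K r (F h i))) :
    ∃ x : ZMod n → W → boxGroup K r,
      (∀ i h k, H.Adj h k → x i h = holonomy (boxVoltage K r) (zigzag F i h k) (2 * n)) ∧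
      (∀ i j h h', (cycle n).Adj i j → H.Adj h h' →
        x i h * boxVoltage K r (F h i) (F h' j) = boxVoltage K r (F h i) (F h' j) * x j h') ∧
      ∀ i₀ h₀, x i₀ h₀ = 1 →
        ∃ ψ : H.Hom (tauImage K r n), ∀ h, (ψ h : ZMod n → X) = F h := by
  have hg := isVoltage_boxVoltage K r
  obtain ⟨x, hx, hconj⟩ := hg.exists_turn hF hnb
  refine ⟨x, hx, ?_, fun i₀ h₀ h0 => ?_⟩
  · rintro i j h h' (rfl | rfl) hh'
    · exact hconj i h h' hh'
    · rw [hg.inv_eq (hF _ _ j (H.symm _ _ hh')), eq_inv_mul_iff_mul_eq, ← mul_assoc,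
        ← hconj _ _ _ (H.symm _ _ hh'), mul_inv_cancel_right]
  · have h1 : ∀ i h, x i h = 1 := hH.cycle_prod_induction hnb hn (S := fun i h => x i h = 1)
      (fun i h h' hh' hi => by
        have := hconj i h h' hh'
        rwa [hi, one_mul, left_eq_mul] at this) h0
    exact exists_hom_tauImage hn hF hr fun h h' hh' => by rw [← hx 0 h h' hh', h1]

theorem spoke_parity_congr {X : Type u} {K : LGraph X} {r a b : X}
    (ha : Nonempty (WalkClass K r a)) (hb : Nonempty (WalkClass K r b)) (h : a = b) :
    (spoke ha).parity = (spoke hb).parity := by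
  subst h; rfl

theorem OddCycle.adj_of_cycle {V : Type u} {G : LGraph V} (C : G.OddCycle) {i j : ZMod C.n}
    (h : (cycle C.n).Adj i j) : G.Adj (C.vert i) (C.vert j) := by
  rcases h with rfl | rfl
  · exact C.adj i
  · exact G.symm _ _ (C.adj j)

/-- If `a` conjugates `x` to `x₀`, `b` conjugates `y` to `x₀`, and `c` conjugates `y` to `x`, then
the loop `a c b⁻¹` commutes with `x₀`. -/
theorem commute_of_conj {Γ : Type*} [Group Γ] {x₀ x y a b c : Γ} (ha : a * x = x₀ * a)
    (hb : b * y = x₀ * b) (hc : x * c = c * y) : Commute x₀ (a * c * b⁻¹) := by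
  have hb' : y * b⁻¹ = b⁻¹ * x₀ := by
    rw [eq_inv_mul_iff_mul_eq, ← mul_assoc, hb, mul_inv_cancel_right]
  change x₀ * (a * c * b⁻¹) = a * c * b⁻¹ * x₀
  rw [mul_assoc (a * c), ← hb', mul_assoc a, ← mul_assoc x₀, ← ha, mul_assoc a, ← mul_assoc x,
    hc]
  simp only [mul_assoc]

section Cross

variable {X : Type u} {V : Type v} {W : Type w} {K : LGraph X} {G : LGraph V} {H : LGraph W}
  {C : G.OddCycle} {D : H.OddCycle}

theorem curryRight_adj (φ : (cross C D).Hom K) {i j : ZMod C.n} (hij : (cycle C.n).Adj i j)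
    {h h' : W} (hh' : H.Adj h h') : K.Adj (curryRight φ h i) (curryRight φ h' j) :=
  φ.map_rel (Or.inr ⟨⟨i, j, hij, rfl, rfl⟩, hh'⟩)

theorem curryLeft_adj (φ : (cross C D).Hom K) {i j : ZMod D.n} (hij : (cycle D.n).Adj i j)
    {a b : V} (hab : G.Adj a b) : K.Adj (curryLeft φ a i) (curryLeft φ b j) :=
  φ.map_rel (Or.inl ⟨hab, ⟨i, j, hij, rfl, rfl⟩⟩)

theorem curryRight_vert (φ : crossVerts C D → X) (i : ZMod C.n) (j : ZMod D.n) :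
    curryRight φ (D.vert j) i = curryLeft φ (C.vert i) j := rfl

/-- A homomorphism from `(G × D) ∪ (C × H)` factors through the image of a power of the universal
cover or through a unicyclic cover, if the component of `K` that it meets has a free
box-fundamental group. -/
theorem exists_factor (hG : G.Connected) (hH : H.Connected) (φ : (cross C D).Hom K) {r : X}
    (hfree : IsFreeGroup (boxGroup K r))
    (hr0 : Nonempty (WalkClass K r (curryRight φ (D.vert 0) 0))) :
    (∃ ψ : H.Hom (tauImage K r C.n), ∀ h, (ψ h : ZMod C.n → X) = curryRight φ h) ∨
    (∃ ψ : G.Hom (tauImage K r D.n), ∀ a, (ψ a : ZMod D.n → X) = curryLeft φ a) ∨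
    ∃ R : Walk K r r, Odd R.length ∧ ∃ ψ : (cross C D).Hom (unicyclicCover K R),
      ∀ p, unicyclicEnd K R (ψ p) = φ p := by
  have : NeZero D.n := ⟨D.odd.pos.ne'⟩
  have hGn := hG.exists_adj C
  have hHn := hH.exists_adj D
  have hF : ∀ h h' i, H.Adj h h' → K.Adj (curryRight φ h i) (curryRight φ h' (i + 1)) :=
    fun h h' i hh' => curryRight_adj φ (Or.inl rfl) hh'
  have hF' : ∀ a b j, G.Adj a b → K.Adj (curryLeft φ a j) (curryLeft φ b (j + 1)) :=
    fun a b j hab => curryLeft_adj φ (Or.inl rfl) hab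
  have hr : ∀ h i, Nonempty (WalkClass K r (curryRight φ h i)) := fun h i =>
    hH.cycle_prod_induction hHn C.odd (S := fun i h => Nonempty (WalkClass K r (curryRight φ h i)))
      (fun i h h' hh' hi => WalkClass.nonempty_of_adj hi (hF h h' i hh')) hr0 i h
  have hr' : ∀ a j, Nonempty (WalkClass K r (curryLeft φ a j)) := fun a j =>
    hG.cycle_prod_induction hGn D.odd (S := fun j a => Nonempty (WalkClass K r (curryLeft φ a j)))
      (fun j a b hab hj => WalkClass.nonempty_of_adj hj (hF' a b j hab))
      (i₀ := 0) (h₀ := C.vert 0) hr0 j a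
  obtain ⟨x, -, hx, hx1⟩ := hH.exists_turn hHn C.odd hF hr
  obtain ⟨y, hy0, hy, hy1⟩ := hG.exists_turn hGn D.odd hF' hr'
  set x₀ := x 0 (D.vert 0) with hx₀
  set y₀ := y 0 (C.vert 0) with hy₀
  rcases eq_or_ne x₀ 1 with h1 | hx₀1
  · exact Or.inl (hx1 _ _ h1)
  rcases eq_or_ne y₀ 1 with h1 | hy₀1
  · exact Or.inr (Or.inl (hy1 _ _ h1))
  refine Or.inr (Or.inr ?_)
  -- The double turn around `D` runs inside `C × D`, so it commutes with the one around `C`.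
  have hxy : Commute x₀ y₀ := by
    have := mul_holonomy (g := boxVoltage K r)
      (p := zigzag (curryLeft φ) 0 (C.vert 0) (C.vert (0 + 1)))
      (x := fun t => x (if Even t then 0 else 0 + 1) (D.vert (0 + t))) (fun t => by
        have hD : H.Adj (D.vert (0 + (t : ZMod D.n))) (D.vert (0 + ((t + 1 : ℕ) : ZMod D.n))) :=
          D.adj_of_cycle (Or.inl (by push_cast; ring))
        by_cases ht : Even t
        · have := hx 0 (0 + 1) _ _ (Or.inl rfl) hD
          simpa only [zigzag, ht, Nat.even_add_one, not_true, if_true, if_false,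
            curryRight_vert] using this
        · have := hx (0 + 1) 0 _ _ (Or.inr rfl) hD
          simpa only [zigzag, ht, Nat.even_add_one, not_false_eq_true, if_true, if_false,
            curryRight_vert] using this) (2 * D.n)
    rw [← hy0 _ _ _ (C.adj 0)] at this
    simpa [Commute, SemiconjBy, hx₀, hy₀] using this
  obtain ⟨ρ, hρx, hρy⟩ := IsFreeGroup.exists_common_centralizer hx₀1 hy₀1 hxy
  -- The diagonal closed walk in `C × D` has odd length and commutes with `x₀`.
  obtain ⟨R, hR, rfl⟩ : ∃ R : Walk K r r, Odd R.length ∧ WalkClass.mk R = ρ := by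
    let p : ℕ → X := fun t => curryRight φ (D.vert t) t
    have hp : ∀ t, K.Adj (p t) (p (t + 1)) := fun t =>
      curryRight_adj φ (Or.inl (Nat.cast_succ _)) (D.adj_of_cycle (Or.inl (Nat.cast_succ _)))
    have hC : ((C.n * D.n : ℕ) : ZMod C.n) = 0 := by simp
    have hD : ((C.n * D.n : ℕ) : ZMod D.n) = 0 := by simp
    have hper : p (C.n * D.n) = p 0 := by
      change curryRight φ (D.vert ((C.n * D.n : ℕ) : ZMod D.n)) ((C.n * D.n : ℕ) : ZMod C.n) =
        curryRight φ (D.vert ((0 : ℕ) : ZMod D.n)) ((0 : ℕ) : ZMod C.n)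
      rw [hC, hD, Nat.cast_zero, Nat.cast_zero]
    refine exists_odd_walk (x := holonomy (boxVoltage K r) p (C.n * D.n)) ?_ (hρx _ ?_)
    · have := parity_holonomy hp (fun t => hr _ _) (C.n * D.n)
      rw [spoke_parity_congr _ (hr (D.vert (0 : ℕ)) (0 : ℕ)) hper, add_comm] at this
      exact (add_left_cancel this).trans ((ZMod.natCast_eq_one_iff_odd).2 (C.odd.mul D.odd))
    · have := mul_holonomy (g := boxVoltage K r) (p := p)
        (x := fun t => x t (D.vert t))
        (fun t => hx _ _ _ _ (Or.inl (Nat.cast_succ _))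
          (D.adj_of_cycle (Or.inl (Nat.cast_succ _)))) (C.n * D.n)
      rwa [hC, hD, Nat.cast_zero, Nat.cast_zero] at this
  have hαx : ∀ i h, ∃ a, a * x i h = x₀ * a :=
    hH.cycle_prod_induction hHn C.odd (S := fun i h => ∃ a, a * x i h = x₀ * a)
      (fun i h h' hh' ⟨a, ha⟩ => ⟨a * boxVoltage K r (curryRight φ h i) (curryRight φ h' (i + 1)),
        by rw [mul_assoc, ← hx _ _ _ _ (Or.inl rfl) hh', ← mul_assoc, ha, mul_assoc]⟩)
      (i₀ := 0) (h₀ := D.vert 0) ⟨1, by rw [one_mul, mul_one]⟩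
  have hαy : ∀ j a, ∃ c, c * y j a = y₀ * c :=
    hG.cycle_prod_induction hGn D.odd (S := fun j a => ∃ c, c * y j a = y₀ * c)
      (fun j a b hab ⟨c, hc⟩ => ⟨c * boxVoltage K r (curryLeft φ a j) (curryLeft φ b (j + 1)),
        by rw [mul_assoc, ← hy _ _ _ _ (Or.inl rfl) hab, ← mul_assoc, hc, mul_assoc]⟩)
      (i₀ := 0) (h₀ := C.vert 0) ⟨1, by rw [one_mul, mul_one]⟩
  -- On `C × D`, one element has to conjugate both turns.
  have hαxy : ∀ i j, ∃ a, a * x i (D.vert j) = x₀ * a ∧ a * y j (C.vert i) = y₀ * a := by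
    refine cycle_connected.cycle_prod_induction (fun j => ⟨j + 1, Or.inl rfl⟩) C.odd
      (S := fun i j => ∃ a, a * x i (D.vert j) = x₀ * a ∧ a * y j (C.vert i) = y₀ * a)
      ?_ (i₀ := 0) (h₀ := (0 : ZMod D.n)) ⟨1, by rw [one_mul, mul_one], by rw [one_mul, mul_one]⟩
    rintro i j j' hj ⟨a, hax, hay⟩
    -- The arc lies in `C × H` and in `G × D`, so its voltage transports both turns.
    refine ⟨a * boxVoltage K r (curryRight φ (D.vert j) i) (curryRight φ (D.vert j') (i + 1)),
      ?_, ?_⟩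
    · rw [mul_assoc, ← hx _ _ _ _ (Or.inl rfl) (D.adj_of_cycle hj), ← mul_assoc, hax, mul_assoc]
    · rw [curryRight_vert, curryRight_vert, mul_assoc, ← hy _ _ _ _ hj (C.adj i), ← mul_assoc,
        hay, mul_assoc]
  have hα : ∀ p : crossVerts C D, ∃ a,
      (∀ i, C.vert i = p.1.1 → a * x i p.1.2 = x₀ * a) ∧
      (∀ j, D.vert j = p.1.2 → a * y j p.1.1 = y₀ * a) := by
    rintro ⟨⟨b, h⟩, hp⟩
    dsimp only
    by_cases hC : b ∈ Set.range C.vert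
    · obtain ⟨i, rfl⟩ := hC
      by_cases hD : h ∈ Set.range D.vert
      · obtain ⟨j, rfl⟩ := hD
        obtain ⟨a, h1, h2⟩ := hαxy i j
        exact ⟨a, fun i' hi => by rwa [C.inj hi], fun j' hj => by rwa [D.inj hj]⟩
      · obtain ⟨a, h1⟩ := hαx i h
        exact ⟨a, fun i' hi => by rwa [C.inj hi], fun j hj => absurd ⟨j, hj⟩ hD⟩
    · obtain ⟨j, rfl⟩ := hp.resolve_right hC
      obtain ⟨a, h1⟩ := hαy j b
      exact ⟨a, fun i hi => absurd ⟨i, hi⟩ hC, fun j' hj => by rwa [D.inj hj]⟩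
  choose α hα using hα
  refine ⟨R, hR, exists_hom_unicyclicCover φ R ?_ α ?_⟩
  · rintro ⟨⟨b, h⟩, hp⟩
    rcases id hp with ⟨j, hj⟩ | ⟨i, hi⟩
    · dsimp only at hj
      subst hj
      exact hr' b j
    · dsimp only at hi
      subst hi
      exact hr h i
  · rintro ⟨⟨b, h⟩, hp⟩ ⟨⟨b', h'⟩, hq⟩ (⟨hb, j, j', hj, hj1, hj2⟩ | ⟨⟨i, i', hi, hi1, hi2⟩, hh⟩)
    · dsimp only at hb hj1 hj2
      subst hj1 hj2
      exact hρy _ (commute_of_conj ((hα _).2 j rfl) ((hα _).2 j' rfl) (hy j j' b b' hj hb))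
    · dsimp only at hh hi1 hi2
      subst hi1 hi2
      exact hρx _ (commute_of_conj ((hα _).1 i rfl) ((hα _).1 i' rfl) (hx i i' h h' hi hh))

end Cross

/-! ### Strong multiplicativity -/

theorem unicyclicEnd_adj {X : Type u} {K : LGraph X} {r : X} (R : Walk K r r) {x y : UniVert K R}
    (h : (unicyclicCover K R).Adj x y) : K.Adj (unicyclicEnd K R x) (unicyclicEnd K R y) := by
  obtain ⟨a, b, ⟨hab, -⟩, rfl, rfl⟩ := h
  exact hab

end LGraph

theorem mainTheorem3 {X : Type*} [Finite X] (K : LGraph X)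
    (T : Set X) (hT : ∀ x : X, ∃ r ∈ T, Nonempty (LGraph.Walk K r x))
    (hfree : ∀ r ∈ T, IsFreeGroup (LGraph.boxGroup K r)) :
    ((∀ r ∈ T, ∀ R : LGraph.Walk K r r, Odd R.length →
          (LGraph.unicyclicCover K R).StronglyMultiplicative) →
      (∀ r ∈ T, ∀ n : ℕ, Odd n → Nonempty ((LGraph.tauImage K r n).Hom K)) →
      K.StronglyMultiplicative) ∧
    (∀ {V W : Type*} [Finite V] [Finite W] (G : LGraph V) (H : LGraph W),
      G.Connected → H.Connected → ∀ (C : G.OddCycle) (D : H.OddCycle)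
        (φ : (LGraph.cross C D).Hom K),
        (∃ r ∈ T, ∃ ψ : H.Hom (LGraph.tauImage K r C.n),
          ∀ h, (ψ h : ZMod C.n → X) = LGraph.curryRight φ h) ∨
        (∃ r ∈ T, ∃ ψ : G.Hom (LGraph.tauImage K r D.n),
          ∀ g, (ψ g : ZMod D.n → X) = LGraph.curryLeft φ g) ∨
        (∃ r ∈ T, ∃ R : LGraph.Walk K r r, Odd R.length ∧
          ∃ ψ : (LGraph.cross C D).Hom (LGraph.unicyclicCover K R),
            ∀ p, LGraph.unicyclicEnd K R (ψ p) = φ p)) := by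
  have base : ∀ x : X, ∃ r ∈ T, Nonempty (LGraph.WalkClass K r x) := fun x => by
    obtain ⟨r, hr, ⟨p⟩⟩ := hT x
    exact ⟨r, hr, ⟨.mk p⟩⟩
  refine ⟨fun hA hB V W _ _ G H hG hH C D ⟨φ⟩ => ?_, fun G H hG hH C D φ => ?_⟩
  · obtain ⟨r, hr, hr0⟩ := base (LGraph.curryRight φ (D.vert 0) 0)
    rcases LGraph.exists_factor hG hH φ (hfree r hr) hr0 with
      ⟨ψ, -⟩ | ⟨ψ, -⟩ | ⟨R, hR, ψ, -⟩
    · exact Or.inr ((hB r hr C.n C.odd).map fun f => f.comp ψ)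
    · exact Or.inl ((hB r hr D.n D.odd).map fun f => f.comp ψ)
    · have e : (LGraph.unicyclicCover K R).Hom K :=
        ⟨LGraph.unicyclicEnd K R, LGraph.unicyclicEnd_adj R⟩
      exact (hA r hr R hR V W G H hG hH C D ⟨ψ⟩).imp (fun h => h.map e.comp)
        (fun h => h.map e.comp)
  · obtain ⟨r, hr, hr0⟩ := base (LGraph.curryRight φ (D.vert 0) 0)
    rcases LGraph.exists_factor hG hH φ (hfree r hr) hr0 with h | h | h
    · exact Or.inl ⟨r, hr, h⟩
    · exact Or.inr (Or.inl ⟨r, hr, h⟩)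
    · exact Or.inr (Or.inr ⟨r, hr, h⟩)
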